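/- Let $R$ be an associative ring with $1$. "Module" means unital right $R$-module. For a class $\mathcal C$ of modules put ${}^\perp\mathcal C=\{M : \mathrm{Ext}^1_R(M,C)=0 \text{ for all } C\in\mathcal C\}$ and $\mathcal C^\perp=\{M : \mathrm{Ext}^1_R(C,M)=0 \text{ for all } C\in\mathcal C\}$. A submodule $N\subseteq M$ is pure if $N\otimes_R X\to M\otimes_R X$ is injective for every left $R$-module $X$. A countable direct limit is the direct limit of a direct system indexed by a (nonempty) countable directed set. A module is countably presented if it is isomorphic to $F/K$ with $F$ free of countable rank and $K$ countably generated (countable includes finite). For a class $\mathcal Q$ of left $R$-modules, $\mathcal D_{\mathcal Q}$ denotes the class of all flat modules $M$ that are $\mathcal Q$-Mittag-Leffler, i.e. such that for every family $(Q_i)_{i\in I}$ of modules in $\mathcal Q$ the canonical map $M\otimes_R\prod_{i\in I} Q_i\to\prod_{i\in I}(M\otimes_R Q_i)$ is injective. (1) Let $\mathcal A'$ be a class of modules closed under products (up to isomorphism). Assume that $\mathcal A'\subseteq\mathcal A={}^\perp\mathcal C$ for some class of modules $\mathcal C$, and that $\mathcal A$ is closed under pure submodules. Then $\mathcal A$ contains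 all countable direct limits of modules in $\mathcal A'$. (2) Let $\mathcal Q$ be a class of left $R$-modules such that $\mathcal D_{\mathcal Q}$ is closed under products. Then ${}^\perp(\mathcal D_{\mathcal Q}^\perp)$ contains all countable direct limits of modules in $\mathcal D_{\mathcal Q}$. In particular, every countably presented flat module belongs to ${}^\perp(\mathcal D_{\mathcal Q}^\perp)$. (3) If $R$ is left Noetherian, then $\mathcal D_{\mathcal Q}$ is closed under products for every class $\mathcal Q$ of left $R$-modules (so the conclusions of (2) hold). -/

import Mathlib

open CategoryTheory
open scoped TensorProduct

universe u

noncomputable section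

namespace RightMod

/-! Right `R`-modules are modules over `Rᵐᵒᵖ`, with `m · r = MulOpposite.op r • m`. -/

section Tensor

variable (R : Type u) [Ring R]

/-- The relations `(m · r) ⊗ n = m ⊗ (r • n)` inside `M ⊗ N` over the integers. -/
def balancedRelations (M N : Type u) [AddCommGroup M] [Module Rᵐᵒᵖ M]
    [AddCommGroup N] [Module R N] : Submodule ℤ (M ⊗[ℤ] N) :=
  Submodule.span ℤ
    {t | ∃ (m : M) (r : R) (n : N), t = (MulOpposite.op r • m) ⊗ₜ[ℤ] n - m ⊗ₜ[ℤ] (r • n)}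

/-- The tensor product over an arbitrary ring `R` of a right module `M` and a left module `N`,
an abelian group. -/
abbrev Tensor (M N : Type u) [AddCommGroup M] [Module Rᵐᵒᵖ M]
    [AddCommGroup N] [Module R N] : Type u :=
  (M ⊗[ℤ] N) ⧸ balancedRelations R M N

variable {R}

theorem balancedRelations_le_comap {M M' N N' : Type u}
    [AddCommGroup M] [Module Rᵐᵒᵖ M] [AddCommGroup M'] [Module Rᵐᵒᵖ M']
    [AddCommGroup N] [Module R N] [AddCommGroup N'] [Module R N']
    (f : M →ₗ[Rᵐᵒᵖ] M') (g : N →ₗ[R] N') :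
    balancedRelations R M N ≤ (balancedRelations R M' N').comap
      (TensorProduct.map f.toAddMonoidHom.toIntLinearMap g.toAddMonoidHom.toIntLinearMap) := by
  refine Submodule.span_le.2 ?_
  rintro _ ⟨m, r, n, rfl⟩
  refine Submodule.subset_span ⟨f m, r, g n, ?_⟩
  simp

/-- The homomorphism `f ⊗ g`. -/
def Tensor.map {M M' N N' : Type u}
    [AddCommGroup M] [Module Rᵐᵒᵖ M] [AddCommGroup M'] [Module Rᵐᵒᵖ M']
    [AddCommGroup N] [Module R N] [AddCommGroup N'] [Module R N']
    (f : M →ₗ[Rᵐᵒᵖ] M') (g : N →ₗ[R] N') : Tensor R M N →ₗ[ℤ] Tensor R M' N' :=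
  Submodule.mapQ _ _
    (TensorProduct.map f.toAddMonoidHom.toIntLinearMap g.toAddMonoidHom.toIntLinearMap)
    (balancedRelations_le_comap f g)

/-- The canonical homomorphism `ρ : M ⊗ ∏ i, Q i → ∏ i, M ⊗ Q i`. -/
def tensorPi (R : Type u) [Ring R] (M : Type u) [AddCommGroup M] [Module Rᵐᵒᵖ M]
    {I : Type u} (Q : I → Type u) [∀ i, AddCommGroup (Q i)] [∀ i, Module R (Q i)] :
    Tensor R M (∀ i, Q i) →ₗ[ℤ] ∀ i, Tensor R M (Q i) :=
  LinearMap.pi fun i => Tensor.map LinearMap.id (LinearMap.proj i)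

end Tensor

variable {R : Type u} [Ring R]

/-- A right module `M` is flat if `M ⊗ -` preserves injectivity of maps of left modules. -/
def IsFlat (R : Type u) [Ring R] (M : Type u) [AddCommGroup M] [Module Rᵐᵒᵖ M] : Prop :=
  ∀ ⦃N N' : Type u⦄ [AddCommGroup N] [Module R N] [AddCommGroup N'] [Module R N']
    (g : N →ₗ[R] N'), Function.Injective g →
      Function.Injective (Tensor.map (LinearMap.id : M →ₗ[Rᵐᵒᵖ] M) g)

/-- `M` is Mittag-Leffler relative to the class `𝒬` of left modules: for every family of members
of `𝒬` the canonical map `ρ` is injective. -/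
def IsMittagLeffler (𝒬 : ObjectProperty (ModuleCat.{u} R))
    (M : Type u) [AddCommGroup M] [Module Rᵐᵒᵖ M] : Prop :=
  ∀ ⦃I : Type u⦄ (Q : I → ModuleCat.{u} R), (∀ i, 𝒬 (Q i)) →
    Function.Injective (tensorPi R M fun i => (Q i : Type u))

/-- The class of flat right modules that are Mittag-Leffler relative to `𝒬`. -/
def flatMittagLeffler (𝒬 : ObjectProperty (ModuleCat.{u} R)) :
    ObjectProperty (ModuleCat.{u} Rᵐᵒᵖ) :=
  fun M => IsFlat R M ∧ IsMittagLeffler 𝒬 M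

/-- A submodule `N` of a right module `M` is pure if `N ⊗ X → M ⊗ X` is injective for every
left module `X`. -/
def IsPure {M : Type u} [AddCommGroup M] [Module Rᵐᵒᵖ M] (N : Submodule Rᵐᵒᵖ M) : Prop :=
  ∀ (X : Type u) [AddCommGroup X] [Module R X],
    Function.Injective (Tensor.map N.subtype (LinearMap.id : X →ₗ[R] X))

/-- `M` has a presentation `0 → K → F → M → 0` with `F` free of countable rank and `K` countably
generated. -/
def IsCountablyPresented (R : Type u) [Ring R] (M : Type u) [AddCommGroup M] [Module Rᵐᵒᵖ M] : Prop :=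
  ∃ (ι : Type) (_ : Countable ι) (p : (ι →₀ Rᵐᵒᵖ) →ₗ[Rᵐᵒᵖ] M), Function.Surjective p ∧
    ∃ S : Set (ι →₀ Rᵐᵒᵖ), S.Countable ∧ Submodule.span Rᵐᵒᵖ S = LinearMap.ker p

/-! Classes of right modules. -/

/-- `⊥𝒞`: the modules `M` with `Ext¹(M, C) = 0` for all `C` in `𝒞`. -/
def leftPerp (𝒞 : ObjectProperty (ModuleCat.{u} Rᵐᵒᵖ)) : ObjectProperty (ModuleCat.{u} Rᵐᵒᵖ) :=
  fun M => ∀ C, 𝒞 C → Subsingleton (Abelian.Ext.{u} M C 1)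

/-- `𝒞⊥`: the modules `M` with `Ext¹(C, M) = 0` for all `C` in `𝒞`. -/
def rightPerp (𝒞 : ObjectProperty (ModuleCat.{u} Rᵐᵒᵖ)) : ObjectProperty (ModuleCat.{u} Rᵐᵒᵖ) :=
  fun M => ∀ C, 𝒞 C → Subsingleton (Abelian.Ext.{u} C M 1)

/-- The direct product of any family of members of `𝒜` is isomorphic to a member of `𝒜`. -/
def ClosedUnderProducts (𝒜 : ObjectProperty (ModuleCat.{u} Rᵐᵒᵖ)) : Prop :=
  ∀ ⦃I : Type u⦄ (M : I → ModuleCat.{u} Rᵐᵒᵖ), (∀ i, 𝒜 (M i)) →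
    𝒜.isoClosure (ModuleCat.of Rᵐᵒᵖ (∀ i, M i))

def ClosedUnderPureSubmodules (𝒜 : ObjectProperty (ModuleCat.{u} Rᵐᵒᵖ)) : Prop :=
  ∀ M : ModuleCat.{u} Rᵐᵒᵖ, 𝒜 M → ∀ N : Submodule Rᵐᵒᵖ M,
    IsPure N → 𝒜 (ModuleCat.of Rᵐᵒᵖ N)

/-- `𝒜` contains the direct limit of every direct system of members of `𝒜'` indexed by a countable
directed set. -/
def ContainsCountableDirectLimits (𝒜 𝒜' : ObjectProperty (ModuleCat.{u} Rᵐᵒᵖ)) : Prop :=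
  ∀ (J : Type) [Preorder J] [IsDirectedOrder J] [Nonempty J] [Countable J]
    (F : J ⥤ ModuleCat.{u} Rᵐᵒᵖ), (∀ j, 𝒜' (F.obj j)) →
      ∀ c : Limits.Cocone F, Limits.IsColimit c → 𝒜 c.pt

end RightMod

end

/-!
Let `M` be the direct limit of a sequence `F 0 → F 1 → ⋯` of modules in `𝒜'`. On the tree with nodes
`(n, x) ∈ ℕ × X` choose branches `s b`, any two of which eventually separate, and let `L` be the
submodule of `∏ (n, x), F n` generated by `K = ⨁ (n, x), F n` and by the threads: families that
follow the transition maps of `F` along one branch. Every finite part of `L` is fixed by some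
homomorphism from the product into `L`, so `L` is pure in the product and `Ext¹(L, C) = 0` for all
`C ∈ 𝒞`. Taking limits along the branches gives an exact sequence `0 → K → L → M^(B) → 0`, hence a
surjection from `Hom(K, C)` onto `Ext¹(M^(B), C)`. If `Ext¹(M, C)` had a non-zero element, the last
group would have at least `2 ^ |B|` elements. For a suitable `X` with `2 ^ |X| ≤ |X| ^ ℵ₀` one can
take all sequences as branches, so `|B| = |X| ^ ℵ₀`, while `|Hom(K, C)| ≤ 2 ^ |X| < 2 ^ |B|`.

A countably presented flat module `E / ker p`, with `E` free, is the limit of a sequence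
`E → E → ⋯` of endomorphisms over it: by the equational criterion finitely many elements of `ker p`
are killed by such an endomorphism, and the generators of `ker p` are killed one after another.

Over a left Noetherian ring a product of flat modules embeds into its factors jointly purely: a
tensor against a finitely generated left module vanishes for reasons recorded by the finitely many
generators of its relation module, so these reasons can be chosen in all factors simultaneously.
-/

noncomputable section

namespace RightMod

open Filter

section Tensor

variable {R : Type u} [Ring R]
variable {M M' N N' : Type u} [AddCommGroup M] [Module Rᵐᵒᵖ M] [AddCommGroup M'] [Module Rᵐᵒᵖ M']
  [AddCommGroup N] [Module R N] [AddCommGroup N'] [Module R N']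

namespace Tensor

variable (R) in
/-- The pure tensor `m ⊗ n`. -/
def tmul (m : M) (n : N) : Tensor R M N :=
  Submodule.Quotient.mk (m ⊗ₜ[ℤ] n)

theorem add_tmul (m m' : M) (n : N) : tmul R (m + m') n = tmul R m n + tmul R m' n := by
  simp [tmul, TensorProduct.add_tmul]

theorem tmul_add (m : M) (n n' : N) : tmul R m (n + n') = tmul R m n + tmul R m n' := by
  simp [tmul, TensorProduct.tmul_add]

theorem smul_tmul (m : M) (r : R) (n : N) :
    tmul R (MulOpposite.op r • m) n = tmul R m (r • n) :=
  (Submodule.Quotient.eq _).2 (Submodule.subset_span ⟨m, r, n, rfl⟩)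

theorem sum_tmul {ι : Type*} (s : Finset ι) (m : ι → M) (n : N) :
    tmul R (∑ i ∈ s, m i) n = ∑ i ∈ s, tmul R (m i) n :=
  map_sum (AddMonoidHom.mk' (tmul R · n) fun _ _ => add_tmul _ _ _) m s

theorem tmul_sum {ι : Type*} (s : Finset ι) (m : M) (n : ι → N) :
    tmul R m (∑ i ∈ s, n i) = ∑ i ∈ s, tmul R m (n i) :=
  map_sum (AddMonoidHom.mk' (tmul R m) (tmul_add m)) n s

@[simp]
theorem tmul_zero (m : M) : tmul R m (0 : N) = 0 :=
  map_zero (AddMonoidHom.mk' (tmul R m) (tmul_add m))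

@[simp]
theorem zero_tmul (n : N) : tmul R (0 : M) n = 0 :=
  map_zero (AddMonoidHom.mk' (tmul R · n) fun _ _ => add_tmul _ _ _)

@[simp]
theorem map_tmul (f : M →ₗ[Rᵐᵒᵖ] M') (g : N →ₗ[R] N') (m : M) (n : N) :
    Tensor.map f g (tmul R m n) = tmul R (f m) (g n) := rfl

@[elab_as_elim]
theorem induction {p : Tensor R M N → Prop} (t : Tensor R M N) (zero : p 0)
    (tmul : ∀ m n, p (tmul R m n)) (add : ∀ x y, p x → p y → p (x + y)) : p t := by
  induction t using Submodule.Quotient.induction_on with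
  | H z =>
    induction z using TensorProduct.induction_on with
    | zero => exact zero
    | tmul m n => exact tmul m n
    | add x y hx hy => exact add _ _ hx hy

theorem hom_ext {P : Type*} [AddCommGroup P] {f g : Tensor R M N →ₗ[ℤ] P}
    (h : ∀ m n, f (tmul R m n) = g (tmul R m n)) : f = g := by
  refine LinearMap.ext fun t => ?_
  induction t using Tensor.induction with
  | zero => simp only [map_zero]
  | tmul m n => exact h m n
  | add x y hx hy => simp only [map_add, hx, hy]

/-- The homomorphism out of `M ⊗ N` induced by a balanced biadditive map. -/
def lift {P : Type*} [AddCommGroup P] (f : M →+ N →+ P)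
    (h : ∀ m (r : R) n, f (MulOpposite.op r • m) n = f m (r • n)) : Tensor R M N →ₗ[ℤ] P :=
  Submodule.liftQ _ (TensorProduct.liftAddHom f (by intro r m n; simp)).toIntLinearMap <| by
    refine Submodule.span_le.2 ?_
    rintro _ ⟨m, r, n, rfl⟩
    simp [h]

theorem map_map {M'' N'' : Type u} [AddCommGroup M''] [Module Rᵐᵒᵖ M''] [AddCommGroup N'']
    [Module R N''] (f : M →ₗ[Rᵐᵒᵖ] M') (g : N →ₗ[R] N') (f' : M' →ₗ[Rᵐᵒᵖ] M'')
    (g' : N' →ₗ[R] N'') (t : Tensor R M N) :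
    Tensor.map f' g' (Tensor.map f g t) = Tensor.map (f' ∘ₗ f) (g' ∘ₗ g) t :=
  LinearMap.congr_fun (f := Tensor.map f' g' ∘ₗ Tensor.map f g)
    (g := Tensor.map (f' ∘ₗ f) (g' ∘ₗ g)) (hom_ext fun _ _ => rfl) t

theorem map_id_id (t : Tensor R M N) :
    Tensor.map (LinearMap.id : M →ₗ[Rᵐᵒᵖ] M) (LinearMap.id : N →ₗ[R] N) t = t :=
  LinearMap.congr_fun (f := Tensor.map LinearMap.id LinearMap.id) (g := LinearMap.id)
    (hom_ext fun _ _ => rfl) t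

theorem map_comm (f : M →ₗ[Rᵐᵒᵖ] M') (g : N →ₗ[R] N') (t : Tensor R M N) :
    Tensor.map LinearMap.id g (Tensor.map f LinearMap.id t) =
      Tensor.map f LinearMap.id (Tensor.map LinearMap.id g t) := by
  rw [map_map, map_map]; rfl

theorem map_sum_left {ι : Type*} (s : Finset ι) (f : ι → M →ₗ[Rᵐᵒᵖ] M') (g : N →ₗ[R] N')
    (t : Tensor R M N) : Tensor.map (∑ i ∈ s, f i) g t = ∑ i ∈ s, Tensor.map (f i) g t := by
  have : Tensor.map (∑ i ∈ s, f i) g = ∑ i ∈ s, Tensor.map (f i) g :=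
    hom_ext fun m n => by simp [sum_tmul]
  simp [this]

theorem eventually_map_eq {ι : Type*} {l : Filter ι} {φ : ι → M →ₗ[Rᵐᵒᵖ] M'}
    {f : M →ₗ[Rᵐᵒᵖ] M'} (h : ∀ m, ∀ᶠ a in l, φ a m = f m) (g : N →ₗ[R] N') (t : Tensor R M N) :
    ∀ᶠ a in l, Tensor.map (φ a) g t = Tensor.map f g t := by
  induction t using Tensor.induction with
  | zero => simp
  | tmul m n => exact (h m).mono fun a ha => by rw [map_tmul, map_tmul, ha]
  | add x y hx hy => filter_upwards [hx, hy] with a hxa hya; rw [map_add, map_add, hxa, hya]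

theorem exists_eq_sum (t : Tensor R M N) :
    ∃ (k : ℕ) (m : Fin k → M) (n : Fin k → N), t = ∑ i, tmul R (m i) (n i) := by
  induction t using Tensor.induction with
  | zero => exact ⟨0, 0, 0, by simp⟩
  | tmul m n => exact ⟨1, fun _ => m, fun _ => n, by simp⟩
  | add x y hx hy =>
    obtain ⟨k, m, n, rfl⟩ := hx
    obtain ⟨l, m', n', rfl⟩ := hy
    exact ⟨k + l, Fin.append m m', Fin.append n n', by simp [Fin.sum_univ_add]⟩

theorem exists_eq_sum_of_span {ι : Type*} [Fintype ι] {n : ι → N}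
    (hn : Submodule.span R (Set.range n) = ⊤) (t : Tensor R M N) :
    ∃ m : ι → M, t = ∑ i, tmul R (m i) (n i) := by
  induction t using Tensor.induction with
  | zero => exact ⟨0, by simp⟩
  | tmul m x =>
    obtain ⟨c, rfl⟩ :=
      (Submodule.mem_span_range_iff_exists_fun R).1 (hn ▸ Submodule.mem_top : x ∈ _)
    exact ⟨fun i => MulOpposite.op (c i) • m, by simp only [tmul_sum, smul_tmul]⟩
  | add x y hx hy =>
    obtain ⟨m, rfl⟩ := hx
    obtain ⟨m', rfl⟩ := hy
    exact ⟨m + m', by simp only [Pi.add_apply, add_tmul, Finset.sum_add_distrib]⟩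

theorem exists_fg_preimage (t : Tensor R M N) :
    ∃ A : Submodule R N, A.FG ∧
      ∃ t' : Tensor R M A, Tensor.map LinearMap.id A.subtype t' = t := by
  obtain ⟨k, m, n, rfl⟩ := exists_eq_sum t
  refine ⟨Submodule.span R (Set.range n), Submodule.fg_span (Set.finite_range n),
    ∑ i, tmul R (m i) ⟨n i, Submodule.subset_span ⟨i, rfl⟩⟩, ?_⟩
  simp

theorem exists_map_ker_subtype_eq {g : N →ₗ[R] N'} (hg : Function.Surjective g) {t : Tensor R M N}
    (ht : Tensor.map LinearMap.id g t = 0) :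
    ∃ s : Tensor R M (LinearMap.ker g),
      Tensor.map LinearMap.id (LinearMap.ker g).subtype s = t := by
  obtain ⟨z, rfl⟩ := Submodule.Quotient.mk_surjective _ t
  let i₀ := (LinearMap.ker g).subtype.toAddMonoidHom.toIntLinearMap
  let g₀ := g.toAddMonoidHom.toIntLinearMap
  have hz : g₀.lTensor M z ∈ balancedRelations R M N' := (Submodule.Quotient.mk_eq_zero _).1 ht
  have relations_lift :
      balancedRelations R M N' ≤ (balancedRelations R M N).map (g₀.lTensor M) := by
    refine Submodule.span_le.2 ?_
    rintro _ ⟨m, r, n, rfl⟩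
    obtain ⟨n, rfl⟩ := hg n
    exact ⟨_, Submodule.subset_span ⟨m, r, n, rfl⟩, by simp [g₀]⟩
  obtain ⟨w, hw, hwz⟩ := relations_lift hz
  have hexact : Function.Exact i₀ g₀ :=
    fun x => ⟨fun hx => ⟨⟨x, hx⟩, rfl⟩, by rintro ⟨y, rfl⟩; exact y.2⟩
  obtain ⟨v, hv⟩ := (lTensor_exact M hexact hg (z - w)).1 (by rw [map_sub, hwz, sub_self])
  refine ⟨Submodule.Quotient.mk v, ?_⟩
  change Submodule.Quotient.mk (i₀.lTensor M v) = _
  rw [hv, Submodule.Quotient.eq, sub_sub_cancel_left]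
  exact neg_mem hw

/-- The isomorphism `Rᵐᵒᵖ ⊗ N ≅ N`, recorded as a homomorphism. -/
def lid : Tensor R Rᵐᵒᵖ N →ₗ[ℤ] N :=
  lift (AddMonoidHom.mk' (fun c => AddMonoidHom.mk' (c.unop • ·) (smul_add c.unop))
    fun a b => by ext; simp [add_smul]) fun m r c => by simp [smul_smul]

@[simp]
theorem lid_tmul (c : Rᵐᵒᵖ) (n : N) : lid (tmul R c n) = c.unop • n := rfl

theorem lid_map (g : N →ₗ[R] N') (t : Tensor R Rᵐᵒᵖ N) :
    lid (Tensor.map LinearMap.id g t) = g (lid t) :=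
  LinearMap.congr_fun (f := lid ∘ₗ Tensor.map LinearMap.id g)
    (g := g.toAddMonoidHom.toIntLinearMap ∘ₗ lid) (hom_ext fun c n => by simp) t

theorem tmul_one_lid (t : Tensor R Rᵐᵒᵖ N) : tmul R 1 (lid t) = t := by
  induction t using Tensor.induction with
  | zero => simp
  | tmul c n => rw [lid_tmul, ← smul_tmul]; simp
  | add x y hx hy => rw [map_add, tmul_add, hx, hy]

theorem lid_injective : Function.Injective (lid : Tensor R Rᵐᵒᵖ N → N) :=
  Function.LeftInverse.injective tmul_one_lid

/-- The isomorphism `M ⊗ R ≅ M`, recorded as a homomorphism. -/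
def rid : Tensor R M R →ₗ[ℤ] M :=
  lift (AddMonoidHom.mk' (fun m => AddMonoidHom.mk' (MulOpposite.op · • m)
    fun a b => by simp [add_smul]) fun a b => by ext; simp) fun m r c => by simp [smul_smul]

@[simp]
theorem rid_tmul (m : M) (r : R) : rid (tmul R m r) = MulOpposite.op r • m := rfl

theorem exists_relations_of_sum_tmul_eq_zero {ι : Type} [Fintype ι] {a : ι → N}
    (ha : Submodule.span R (Set.range a) = ⊤) {m : ι → M} (h : ∑ i, tmul R (m i) (a i) = 0) :
    ∃ s : Tensor R M (LinearMap.ker (Fintype.linearCombination R a)),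
      ∀ i, m i = rid (Tensor.map LinearMap.id (LinearMap.proj i ∘ₗ Submodule.subtype _) s) := by
  classical
  have hsurj : Function.Surjective (Fintype.linearCombination R a) := by
    rw [← LinearMap.range_eq_top, Fintype.range_linearCombination, ha]
  obtain ⟨s, hs⟩ := exists_map_ker_subtype_eq hsurj
    (t := ∑ i, tmul R (m i) (Pi.single i 1 : ι → R)) (by
      simpa [Fintype.linearCombination_apply_single] using h)
  refine ⟨s, fun i => ?_⟩
  rw [← LinearMap.comp_id LinearMap.id, ← map_map, hs]
  simp [Pi.single_apply, apply_ite MulOpposite.op, ite_smul]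

theorem sum_tmul_eq_zero_of_relations {ι σ : Type*} [Fintype ι] [Fintype σ] {a : ι → N} {m : ι → M}
    {κ : σ → ι → R} {y : σ → M} (hκ : ∀ s, ∑ i, κ s i • a i = 0)
    (hm : ∀ i, m i = ∑ s, MulOpposite.op (κ s i) • y s) : ∑ i, tmul R (m i) (a i) = 0 := by
  simp only [hm, sum_tmul, smul_tmul]
  rw [Finset.sum_comm]
  simp only [← tmul_sum, hκ, tmul_zero, Finset.sum_const_zero]

end Tensor

theorem IsFlat.equational_criterion {ι : Type} [Fintype ι] (hM : IsFlat R M) {m : ι → M}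
    {r : ι → R} (h : ∑ i, MulOpposite.op (r i) • m i = 0) :
    ∃ (l : ℕ) (κ : Fin l → ι → R) (y : Fin l → M),
      (∀ s, ∑ i, κ s i * r i = 0) ∧ ∀ i, m i = ∑ s, MulOpposite.op (κ s i) • y s := by
  let A := Submodule.span R (Set.range r)
  let a (i : ι) : A := ⟨r i, Submodule.subset_span ⟨i, rfl⟩⟩
  have ha : Submodule.span R (Set.range a) = ⊤ :=
    Submodule.map_injective_of_injective A.subtype_injective <| by
      rw [Submodule.map_span, ← Set.range_comp, Submodule.map_top, Submodule.range_subtype]; rfl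
  have hzero : ∑ i, Tensor.tmul R (m i) (a i) = 0 := hM A.subtype A.subtype_injective <| by
    have (i : ι) : Tensor.tmul R (m i) (r i) = Tensor.tmul R (MulOpposite.op (r i) • m i) 1 := by
      rw [Tensor.smul_tmul, smul_eq_mul, mul_one]
    simp only [map_sum, Tensor.map_tmul, LinearMap.id_apply, Submodule.subtype_apply, a, this,
      ← Tensor.sum_tmul, h, Tensor.zero_tmul, map_zero]
  obtain ⟨s, hs⟩ := Tensor.exists_relations_of_sum_tmul_eq_zero ha hzero
  obtain ⟨l, y, κ, rfl⟩ := s.exists_eq_sum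
  refine ⟨l, fun s => κ s, y, fun s => ?_, by simpa using hs⟩
  have hκ := LinearMap.mem_ker.1 (κ s).2
  rw [Fintype.linearCombination_apply] at hκ
  simpa [a] using congrArg A.subtype hκ

end Tensor

section JointPurity

variable {R : Type u} [Ring R] {M : Type u} [AddCommGroup M] [Module Rᵐᵒᵖ M]

/-- A family of homomorphisms `j i : M → P i` is jointly pure if the homomorphisms
`j i ⊗ X : M ⊗ X → P i ⊗ X` are jointly injective for every left module `X`. A single inclusion
is jointly pure exactly when its range is a pure submodule. -/
def IsJointlyPure {I : Type*} {P : I → Type u} [∀ i, AddCommGroup (P i)] [∀ i, Module Rᵐᵒᵖ (P i)]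
    (j : ∀ i, M →ₗ[Rᵐᵒᵖ] P i) : Prop :=
  ∀ (X : Type u) [AddCommGroup X] [Module R X] (t : Tensor R M X),
    (∀ i, Tensor.map (j i) (LinearMap.id : X →ₗ[R] X) t = 0) → t = 0

namespace IsJointlyPure

variable {I : Type*} {P : I → Type u} [∀ i, AddCommGroup (P i)] [∀ i, Module Rᵐᵒᵖ (P i)]
  {j : ∀ i, M →ₗ[Rᵐᵒᵖ] P i}

theorem isFlat (hj : IsJointlyPure j) (hP : ∀ i, IsFlat R (P i)) : IsFlat R M := by
  intro N N' _ _ _ _ g hg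
  refine (injective_iff_map_eq_zero _).2 fun t ht => hj N t fun i => ?_
  refine (injective_iff_map_eq_zero _).1 (hP i g hg) _ ?_
  rw [Tensor.map_comm, ht, map_zero]

theorem isMittagLeffler {𝒬 : ObjectProperty (ModuleCat.{u} R)} (hj : IsJointlyPure j)
    (hP : ∀ i, IsMittagLeffler 𝒬 (P i)) : IsMittagLeffler 𝒬 M := by
  intro K Q hQ
  refine (injective_iff_map_eq_zero _).2 fun t ht => hj _ t fun i => ?_
  refine (injective_iff_map_eq_zero _).1 (hP i Q hQ) _ (funext fun k => ?_)
  have hk : Tensor.map LinearMap.id (LinearMap.proj k) t = 0 := congrFun ht k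
  rw [tensorPi, LinearMap.pi_apply, Tensor.map_comm, hk, map_zero, Pi.zero_apply]

theorem flatMittagLeffler {𝒬 : ObjectProperty (ModuleCat.{u} R)} (hj : IsJointlyPure j)
    (hP : ∀ i, flatMittagLeffler 𝒬 (ModuleCat.of Rᵐᵒᵖ (P i))) :
    RightMod.flatMittagLeffler 𝒬 (ModuleCat.of Rᵐᵒᵖ M) :=
  ⟨hj.isFlat fun i => (hP i).1, hj.isMittagLeffler fun i => (hP i).2⟩

end IsJointlyPure

theorem isJointlyPure_basis_coord {ι : Type*} (b : Module.Basis ι Rᵐᵒᵖ M) :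
    IsJointlyPure b.coord := by
  intro X _ _ t ht
  let φ (T : Finset ι) : M →ₗ[Rᵐᵒᵖ] M :=
    ∑ i ∈ T, LinearMap.toSpanSingleton Rᵐᵒᵖ M (b i) ∘ₗ b.coord i
  have hφ (m : M) : ∀ᶠ T in atTop, φ T m = (LinearMap.id : M →ₗ[Rᵐᵒᵖ] M) m := by
    filter_upwards [eventually_ge_atTop (b.repr m).support] with T hT
    conv_rhs => rw [LinearMap.id_apply, ← b.linearCombination_repr m,
      Finsupp.linearCombination_apply, Finsupp.sum_of_support_subset _ hT _ (by simp)]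
    simp [φ]
  obtain ⟨T, hT⟩ := (Tensor.eventually_map_eq hφ LinearMap.id t).exists
  rw [Tensor.map_id_id] at hT
  rw [← hT, Tensor.map_sum_left]
  refine Finset.sum_eq_zero fun i _ => ?_
  rw [← LinearMap.id_comp (LinearMap.id : X →ₗ[R] X), ← Tensor.map_map, ht, map_zero]

theorem flatMittagLeffler_self (𝒬 : ObjectProperty (ModuleCat.{u} R)) :
    flatMittagLeffler 𝒬 (ModuleCat.of Rᵐᵒᵖ Rᵐᵒᵖ) := by
  refine ⟨fun N N' _ _ _ _ g hg => ?_, fun I Q _ => ?_⟩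
  · refine fun s t hst => Tensor.lid_injective (hg ?_)
    rw [← Tensor.lid_map, ← Tensor.lid_map, hst]
  · refine fun s t hst => Tensor.lid_injective (funext fun i => ?_)
    have hi := congrArg Tensor.lid (congrFun hst i)
    rwa [tensorPi, LinearMap.pi_apply, LinearMap.pi_apply, Tensor.lid_map, Tensor.lid_map] at hi

theorem flatMittagLeffler_of_free (𝒬 : ObjectProperty (ModuleCat.{u} R)) [Module.Free Rᵐᵒᵖ M] :
    flatMittagLeffler 𝒬 (ModuleCat.of Rᵐᵒᵖ M) :=
  (isJointlyPure_basis_coord (Module.Free.chooseBasis Rᵐᵒᵖ M)).flatMittagLeffler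
    fun _ => flatMittagLeffler_self 𝒬

theorem flatMittagLeffler_isoClosure_le (𝒬 : ObjectProperty (ModuleCat.{u} R)) :
    (flatMittagLeffler 𝒬).isoClosure ≤ flatMittagLeffler 𝒬 := by
  rintro M ⟨N, hN, ⟨e⟩⟩
  have : IsJointlyPure fun _ : Unit => e.hom.hom := fun X _ _ t ht => by
    have := congrArg (Tensor.map e.inv.hom LinearMap.id) (ht ())
    rwa [map_zero, Tensor.map_map, ← ModuleCat.hom_comp, e.hom_inv_id, LinearMap.comp_id,
      ModuleCat.hom_id, Tensor.map_id_id] at this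
  exact this.flatMittagLeffler fun _ => hN

theorem closedUnderPureSubmodules_flatMittagLeffler (𝒬 : ObjectProperty (ModuleCat.{u} R)) :
    ClosedUnderPureSubmodules (flatMittagLeffler 𝒬) := by
  intro M hM N hN
  have : IsJointlyPure fun _ : Unit => N.subtype := fun X _ _ t ht =>
    (injective_iff_map_eq_zero _).1 (hN X) t (ht ())
  exact this.flatMittagLeffler fun _ => hM

end JointPurity

section Noetherian

variable {R : Type u} [Ring R] [IsNoetherianRing R] {I : Type u} {M : I → Type u}
  [∀ i, AddCommGroup (M i)] [∀ i, Module Rᵐᵒᵖ (M i)]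

theorem Tensor.eq_zero_of_map_proj_eq_zero {N : Type u} [AddCommGroup N] [Module R N]
    [Module.Finite R N] {t : Tensor R (∀ i, M i) N}
    (ht : ∀ i, Tensor.map (LinearMap.proj i : (∀ i, M i) →ₗ[Rᵐᵒᵖ] M i) LinearMap.id t = 0) :
    t = 0 := by
  obtain ⟨k, n, hn⟩ := Module.Finite.exists_fin (R := R) (M := N)
  obtain ⟨m, rfl⟩ := Tensor.exists_eq_sum_of_span hn t
  obtain ⟨l, κ, hκ⟩ :=
    Module.Finite.exists_fin (R := R) (M := LinearMap.ker (Fintype.linearCombination R n))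
  have combination (i : I) : ∃ y : Fin l → M i,
      ∀ s, m s i = ∑ t, MulOpposite.op ((κ t : Fin k → R) s) • y t := by
    obtain ⟨z, hz⟩ := Tensor.exists_relations_of_sum_tmul_eq_zero hn
      (m := fun s => m s i) (by simpa using ht i)
    obtain ⟨y, rfl⟩ := Tensor.exists_eq_sum_of_span hκ z
    exact ⟨y, by simpa using hz⟩
  choose y hy using combination
  refine Tensor.sum_tmul_eq_zero_of_relations (κ := fun t => κ t) (y := fun t i => y i t)
    (fun t => (Fintype.linearCombination_apply R n _).symm.trans (κ t).2) fun s => ?_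
  ext i
  simp [hy]

theorem isJointlyPure_proj (hM : ∀ i, IsFlat R (M i)) :
    IsJointlyPure fun i => (LinearMap.proj i : (∀ i, M i) →ₗ[Rᵐᵒᵖ] M i) := by
  intro X _ _ t ht
  obtain ⟨A, hA, t, rfl⟩ := t.exists_fg_preimage
  have := Module.Finite.of_fg hA
  rw [Tensor.eq_zero_of_map_proj_eq_zero (t := t), map_zero]
  refine fun i => (injective_iff_map_eq_zero _).1 (hM i A.subtype A.subtype_injective) _ ?_
  rw [Tensor.map_comm, ht]

theorem closedUnderProducts_flatMittagLeffler (𝒬 : ObjectProperty (ModuleCat.{u} R)) :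
    ClosedUnderProducts (flatMittagLeffler 𝒬) :=
  fun _ M hM => ObjectProperty.le_isoClosure _ _ <|
    (isJointlyPure_proj (M := fun i => M i) fun i => (hM i).1).flatMittagLeffler hM

end Noetherian

section Ext

open Abelian Cardinal

theorem extClass_comp_mk₀_surjective {𝒞 : Type*} [Category 𝒞] [Abelian 𝒞] [HasExt 𝒞]
    {T : ShortComplex 𝒞} (hT : T.ShortExact) (C : 𝒞) [Subsingleton (Ext T.X₂ C 1)] :
    Function.Surjective fun d : T.X₁ ⟶ C => hT.extClass.comp (Ext.mk₀ d) (add_zero 1) := by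
  intro ξ
  obtain ⟨x, hx⟩ := Ext.contravariant_sequence_exact₃ hT C ξ (Subsingleton.elim _ _) (add_zero 1)
  obtain ⟨d, rfl⟩ := Ext.homEquiv₀.symm.surjective x
  exact ⟨d, hx⟩

variable {S : Type u} [Ring S] {B K L M : Type u} [AddCommGroup K] [Module S K] [AddCommGroup L]
  [Module S L] [AddCommGroup M] [Module S M] (C : ModuleCat.{u} S)

theorem two_power_le_mk_ext_finsupp {n : ℕ} {ξ : Ext.{u} (ModuleCat.of S M) C n} (hξ : ξ ≠ 0) :
    2 ^ #B ≤ #(Ext.{u} (ModuleCat.of S (B →₀ M)) C n) := by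
  classical
  let σ (s : Set B) : (B →₀ M) →ₗ[S] M :=
    Finsupp.lsum ℕ fun b => if b ∈ s then LinearMap.id else 0
  let pullback (s : Set B) : Ext.{u} (ModuleCat.of S (B →₀ M)) C n :=
    (Ext.mk₀ (ModuleCat.ofHom (σ s))).comp ξ (zero_add n)
  have restrict_pullback (s : Set B) (b : B) :
      (Ext.mk₀ (ModuleCat.ofHom (Finsupp.lsingle b))).comp (pullback s) (zero_add n) =
        if b ∈ s then ξ else 0 := by
    have hσ : σ s ∘ₗ Finsupp.lsingle b = if b ∈ s then LinearMap.id else 0 := by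
      ext m
      simp [σ]
    rw [Ext.mk₀_comp_mk₀_assoc, ← ModuleCat.ofHom_comp, hσ]
    split_ifs
    · exact Ext.mk₀_id_comp ξ
    · rw [ModuleCat.ofHom_zero, Ext.mk₀_zero, Ext.zero_comp]
  rw [← mk_set]
  refine mk_le_of_injective (f := pullback) fun s t hst => Set.ext fun b => ?_
  have hb := restrict_pullback s b
  rw [hst, restrict_pullback t b] at hb
  by_cases hs : b ∈ s <;> by_cases ht : b ∈ t <;> simp_all

theorem subsingleton_ext_of_mk_hom_lt {i : K →ₗ[S] L} {p : L →ₗ[S] (B →₀ M)}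
    (hi : Function.Injective i) (hp : Function.Surjective p) (hip : Function.Exact i p)
    (hL : Subsingleton (Ext.{u} (ModuleCat.of S L) C 1)) (hK : #(K →ₗ[S] C) < 2 ^ #B) :
    Subsingleton (Ext.{u} (ModuleCat.of S M) C 1) := by
  refine subsingleton_of_forall_eq 0 fun ξ => of_not_not fun hξ => hK.not_ge ?_
  let T : ShortComplex (ModuleCat.{u} S) :=
    ShortComplex.mk (ModuleCat.ofHom i) (ModuleCat.ofHom p)
      (ModuleCat.hom_ext (LinearMap.ext hip.apply_apply_eq_zero))
  have hT : T.ShortExact := ShortComplex.ShortExact.mk'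
    ((ShortComplex.ShortExact.moduleCat_exact_iff_function_exact T).2 hip)
    ((ModuleCat.mono_iff_injective _).2 hi) ((ModuleCat.epi_iff_surjective _).2 hp)
  have : Subsingleton (Ext T.X₂ C 1) := hL
  calc 2 ^ #B ≤ #(Ext T.X₃ C 1) := two_power_le_mk_ext_finsupp C hξ
    _ ≤ #(T.X₁ ⟶ C) := mk_le_of_surjective (extClass_comp_mk₀_surjective hT C)
    _ = #(K →ₗ[S] C) := mk_congr ModuleCat.homEquiv

end Ext

section Perp

open Abelian

variable {R : Type u} [Ring R]

theorem leftPerp_of_iso {𝒞 : ObjectProperty (ModuleCat.{u} Rᵐᵒᵖ)} {M N : ModuleCat.{u} Rᵐᵒᵖ}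
    (e : M ≅ N) (hN : leftPerp 𝒞 N) : leftPerp 𝒞 M := by
  refine fun C hC => subsingleton_of_forall_eq 0 fun ξ => ?_
  have h : (Ext.mk₀ e.hom).comp ((Ext.mk₀ e.inv).comp ξ (zero_add 1)) (zero_add 1) = ξ := by
    rw [Ext.mk₀_comp_mk₀_assoc, e.hom_inv_id, Ext.mk₀_id_comp]
  rw [← h, (hN C hC).elim ((Ext.mk₀ e.inv).comp ξ (zero_add 1)) 0, Ext.comp_zero]

theorem isoClosure_leftPerp (𝒞 : ObjectProperty (ModuleCat.{u} Rᵐᵒᵖ)) :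
    (leftPerp 𝒞).isoClosure = leftPerp 𝒞 :=
  have : (leftPerp 𝒞).IsClosedUnderIsomorphisms := ⟨fun e h => leftPerp_of_iso e.symm h⟩
  ObjectProperty.isoClosure_eq_self _

theorem le_leftPerp_rightPerp (𝒜 : ObjectProperty (ModuleCat.{u} Rᵐᵒᵖ)) :
    𝒜 ≤ leftPerp (rightPerp 𝒜) :=
  fun M hM _ hC => hC M hM

end Perp

section Cardinality

open Cardinal

theorem exists_two_power_le_mk_sequences (Z : Type u) :
    ∃ X : Type u, #Z ≤ #X ∧ 2 ^ #X ≤ #(ℕ → X) := by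
  -- A subset of `X = Z ⊔ 𝒫 Z ⊔ 𝒫 (𝒫 Z) ⊔ ⋯` is the sequence of its traces on the summands, and
  -- each trace is itself an element of `X`.
  let T : ℕ → Type u := Nat.rec Z fun _ Y => Set Y
  let trace (s : Set (Σ n, T n)) (n : ℕ) : T (n + 1) := {t : T n | (⟨n, t⟩ : Σ n, T n) ∈ s}
  refine ⟨Σ n, T n, mk_le_of_injective (sigma_mk_injective (β := T) (i := 0)), ?_⟩
  rw [← mk_set]
  refine mk_le_of_injective (f := fun s n => ⟨n + 1, trace s n⟩) fun s t hst => ?_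
  ext ⟨n, x⟩
  have hn : trace s n = trace t n := sigma_mk_injective (congrFun hst n)
  exact Set.ext_iff.1 hn x

/-- Any two distinct branches `s b` and `s b'` differ at all but finitely many levels. -/
def IsAlmostDisjoint {B X : Type*} (s : B → ℕ → X) : Prop :=
  Pairwise fun b b' => ∀ᶠ n in atTop, s b n ≠ s b' n

theorem exists_isAlmostDisjoint (X : Type u) [Infinite X] :
    ∃ s : (ℕ → X) → ℕ → X, IsAlmostDisjoint s := by
  obtain ⟨e⟩ := Cardinal.eq.1 (mk_list_eq_mk X)
  refine ⟨fun b n => e ((List.range n).map b), fun b b' hbb' => ?_⟩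
  obtain ⟨k, hk⟩ := Function.ne_iff.1 hbb'
  filter_upwards [eventually_gt_atTop k] with n hn heq
  exact hk (List.map_inj_left.1 (e.injective heq) k (List.mem_range.2 hn))

theorem mk_dfinsupp_hom_le {S ι : Type u} [Ring S] {A : ι → Type u} [∀ i, AddCommGroup (A i)]
    [∀ i, Module S (A i)] {C : Type u} [AddCommGroup C] [Module S C] {κ : Cardinal.{u}}
    (hκ : ℵ₀ ≤ κ) (hA : #(Σ i, A i) ≤ κ) (hC : #C ≤ κ) : #((Π₀ i, A i) →ₗ[S] C) ≤ 2 ^ κ := by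
  classical
  let values (d : (Π₀ i, A i) →ₗ[S] C) (a : Σ i, A i) : C := d (DFinsupp.single a.1 a.2)
  have values_injective : Function.Injective values := fun d d' h =>
    DFinsupp.lhom_ext fun i x => congrFun h ⟨i, x⟩
  calc #((Π₀ i, A i) →ₗ[S] C) ≤ #C ^ #(Σ i, A i) := mk_le_of_injective values_injective
    _ ≤ κ ^ #(Σ i, A i) := power_le_power_right hC
    _ ≤ κ ^ κ := power_le_power_left (aleph0_pos.trans_le hκ).ne' hA
    _ = 2 ^ κ := power_self_eq hκ

end Cardinality

section TreeModule

variable {S : Type u} [Ring S] (F : ℕ ⥤ ModuleCat.{u} S) {B X : Type u}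

/-- The threads along the branch `b` that start at level `N`: the element `x` of `F N` gives the
family with entry `F (N ≤ n) x` at the node `(n, b n)` for `n ≥ N`, and zero at all other nodes. -/
def thread (b : ℕ → X) (N : ℕ) : F.obj N →ₗ[S] ∀ η : ℕ × X, F.obj η.1 :=
  open Classical in
  LinearMap.pi fun η => if h : N ≤ η.1 ∧ η.2 = b η.1 then (F.map (homOfLE h.1)).hom else 0

variable {F}

theorem thread_apply_self {b : ℕ → X} {N n : ℕ} (h : N ≤ n) (x : F.obj N) :
    thread F b N x (n, b n) = F.map (homOfLE h) x := by
  simp [thread, h]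

theorem thread_apply_of_ne {b : ℕ → X} {N : ℕ} {η : ℕ × X} (h : η.2 ≠ b η.1) (x : F.obj N) :
    thread F b N x η = 0 := by
  simp [thread, h]

variable (F X) in
/-- The families of elements of the `F n`, indexed by the nodes `(n, x)`, with finite support. -/
abbrev finitelySupported : Submodule S (∀ η : ℕ × X, F.obj η.1) :=
  LinearMap.range (DFinsupp.coeFnLinearMap S)

theorem mem_finitelySupported {y : ∀ η : ℕ × X, F.obj η.1} {T : Set (ℕ × X)} (hT : T.Finite)
    (h : ∀ η ∉ T, y η = 0) : y ∈ finitelySupported F X := by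
  classical
  refine ⟨DFinsupp.mk hT.toFinset fun η => y η, funext fun η => ?_⟩
  by_cases hη : η ∈ T <;> simp [hη, h]

theorem eventually_apply_eq_zero {y : ∀ η : ℕ × X, F.obj η.1} (hy : y ∈ finitelySupported F X) :
    ∀ᶠ n in atTop, ∀ x, y (n, x) = 0 := by
  classical
  obtain ⟨k, rfl⟩ := hy
  obtain ⟨n₀, hn₀⟩ := (k.support.image Prod.fst).bddAbove
  filter_upwards [eventually_gt_atTop n₀] with n hn x
  by_contra hx
  exact hn.not_ge (hn₀ (Finset.mem_image_of_mem Prod.fst (DFinsupp.mem_support_iff.2 hx)))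

theorem thread_sub_thread_mem_finitelySupported (b : ℕ → X) {N n : ℕ} (h : N ≤ n) (x : F.obj N) :
    thread F b N x - thread F b n (F.map (homOfLE h) x) ∈ finitelySupported F X := by
  refine mem_finitelySupported ((Set.finite_lt_nat n).image fun k => (k, b k)) ?_
  rintro ⟨k, z⟩ hk
  by_cases hz : z = b k
  · subst hz
    have hnk : n ≤ k := not_lt.1 fun hkn => hk ⟨k, hkn, rfl⟩
    rw [Pi.sub_apply, thread_apply_self (h.trans hnk), thread_apply_self hnk, sub_eq_zero,
      ← homOfLE_comp h hnk, Functor.map_comp, ConcreteCategory.comp_apply]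
  · rw [Pi.sub_apply, thread_apply_of_ne hz, thread_apply_of_ne hz, sub_zero]

theorem thread_mem_finitelySupported (b : ℕ → X) {N n : ℕ} {h : N ⟶ n} {x : F.obj N}
    (hx : F.map h x = 0) : thread F b N x ∈ finitelySupported F X := by
  have := thread_sub_thread_mem_finitelySupported b (leOfHom h) x
  rwa [Subsingleton.elim (homOfLE _) h, hx, map_zero, sub_zero] at this

variable (F) in
/-- The submodule of `∏ (n, x), F n` generated by the families of finite support and by the
threads along the branches `s b`. -/
def treeModule (s : B → ℕ → X) : Submodule S (∀ η : ℕ × X, F.obj η.1) :=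
  finitelySupported F X ⊔ ⨆ (b : B) (N : ℕ), LinearMap.range (thread F (s b) N)

variable {s : B → ℕ → X}

theorem finitelySupported_le_treeModule : finitelySupported F X ≤ treeModule F s :=
  le_sup_left

theorem thread_mem_treeModule (b : B) (N : ℕ) (x : F.obj N) :
    thread F (s b) N x ∈ treeModule F s :=
  (le_iSup₂_of_le (f := fun b N => LinearMap.range (thread F (s b) N)) b N le_rfl).trans
    le_sup_right ⟨x, rfl⟩

@[elab_as_elim]
theorem treeModule_induction {p : (∀ η : ℕ × X, F.obj η.1) → Prop}
    (finite : ∀ y ∈ finitelySupported F X, p y) (thread : ∀ b N x, p (thread F (s b) N x))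
    (add : ∀ y z, p y → p z → p (y + z)) {y : ∀ η : ℕ × X, F.obj η.1} (hy : y ∈ treeModule F s) :
    p y := by
  obtain ⟨k, hk, z, hz, rfl⟩ := Submodule.mem_sup.1 hy
  refine add k z (finite k hk) ?_
  rw [iSup_sigma'] at hz
  refine Submodule.iSup_induction _ (motive := p) hz ?_ (finite 0 (zero_mem _)) add
  rintro ⟨b, N⟩ _ ⟨x, rfl⟩
  exact thread b N x

variable (F s) in
/-- The sum of the threads through the level `N` entries of a family along the branches in `W`. -/
def branchPart (W : Finset B) (N : ℕ) :
    (∀ η : ℕ × X, F.obj η.1) →ₗ[S] ∀ η : ℕ × X, F.obj η.1 :=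
  ∑ b ∈ W, thread F (s b) N ∘ₗ LinearMap.proj (N, s b N)

theorem branchPart_apply (W : Finset B) (N : ℕ) (y : ∀ η : ℕ × X, F.obj η.1) :
    branchPart F s W N y = ∑ b ∈ W, thread F (s b) N (y (N, s b N)) := by
  simp [branchPart]

theorem branchPart_mem_treeModule (W : Finset B) (N : ℕ) (y : ∀ η : ℕ × X, F.obj η.1) :
    branchPart F s W N y ∈ treeModule F s := by
  rw [branchPart_apply]
  exact sum_mem fun b _ => thread_mem_treeModule b N _

theorem eventually_branchPart_thread (hs : IsAlmostDisjoint s)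
    {W : Finset B} {b : B} (hb : b ∈ W) (N : ℕ) (x : F.obj N) :
    ∀ᶠ n in atTop, ∃ h : N ≤ n,
      branchPart F s W n (thread F (s b) N x) = thread F (s b) n (F.map (homOfLE h) x) := by
  have hW : ∀ᶠ n in atTop, ∀ b' ∈ W, b' ≠ b → s b' n ≠ s b n :=
    W.eventually_all.2 fun b' _ => eventually_imp_distrib_left.2 fun h => hs h
  filter_upwards [hW, eventually_ge_atTop N] with n hn hNn
  refine ⟨hNn, ?_⟩
  rw [branchPart_apply, Finset.sum_eq_single_of_mem b hb, thread_apply_self hNn]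
  intro b' hb' hne
  rw [thread_apply_of_ne (η := (n, s b' n)) (hn b' hb' hne), map_zero]

theorem eventually_sub_branchPart_mem_finitelySupported
    (hs : IsAlmostDisjoint s)
    {y : ∀ η : ℕ × X, F.obj η.1} (hy : y ∈ treeModule F s) :
    ∀ᶠ W in atTop, ∀ᶠ N in atTop, y - branchPart F s W N y ∈ finitelySupported F X := by
  refine treeModule_induction (fun y hy => ?_) (fun b N x => ?_) (fun y z hy hz => ?_) hy
  · refine Eventually.of_forall fun W => ?_
    filter_upwards [eventually_apply_eq_zero hy] with N hN
    simpa [branchPart_apply, hN] using hy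
  · filter_upwards [eventually_ge_atTop {b}] with W hW
    filter_upwards [eventually_branchPart_thread hs (Finset.singleton_subset_iff.1 hW) N x]
    rintro n ⟨hNn, hn⟩
    rw [hn]
    exact thread_sub_thread_mem_finitelySupported (s b) hNn x
  · filter_upwards [hy, hz] with W hyW hzW
    filter_upwards [hyW, hzW] with N hyN hzN
    rw [map_add, add_sub_add_comm]
    exact add_mem hyN hzN

end TreeModule

section TreeModulePurity

instance neBot_curry {α β : Type*} {l : Filter α} {m : Filter β} [l.NeBot] [hm : m.NeBot] :
    (l.curry m).NeBot :=
  (frequently_true_iff_neBot _).1 <| (frequently_curry_iff _).2 <| by simpa using hm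

variable {R : Type u} [Ring R] {F : ℕ ⥤ ModuleCat.{u} Rᵐᵒᵖ} {B X : Type u} {s : B → ℕ → X}

theorem isPure_of_eventually_eq {M : Type u} [AddCommGroup M] [Module Rᵐᵒᵖ M]
    {L : Submodule Rᵐᵒᵖ M} {ι : Type*} {l : Filter ι} [l.NeBot] (φ : ι → M →ₗ[Rᵐᵒᵖ] L)
    (hφ : ∀ y : L, ∀ᶠ a in l, φ a y = y) : IsPure L := by
  refine fun Y _ _ => (injective_iff_map_eq_zero _).2 fun t ht => ?_
  have hid : ∀ᶠ a in l, Tensor.map (φ a ∘ₗ L.subtype) LinearMap.id t = t := by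
    simpa only [Tensor.map_id_id] using
      Tensor.eventually_map_eq (f := LinearMap.id) hφ LinearMap.id t
  obtain ⟨a, ha⟩ := hid.exists
  rw [← ha, ← LinearMap.id_comp (LinearMap.id : Y →ₗ[R] Y), ← Tensor.map_map, ht, map_zero]

theorem isPure_treeModule (hs : IsAlmostDisjoint s) :
    IsPure (treeModule F s) := by
  classical
  let restrict (T : Finset (ℕ × X)) :
      (∀ η : ℕ × X, F.obj η.1) →ₗ[Rᵐᵒᵖ] ∀ η : ℕ × X, F.obj η.1 :=
    LinearMap.pi fun η => if η ∈ T then LinearMap.proj η else 0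
  have restrict_mem (T : Finset (ℕ × X)) (y : ∀ η : ℕ × X, F.obj η.1) :
      restrict T y ∈ finitelySupported F X :=
    mem_finitelySupported T.finite_toSet fun η hη => by simp_all [restrict]
  have eventually_restrict {y : ∀ η : ℕ × X, F.obj η.1} (hy : y ∈ finitelySupported F X) :
      ∀ᶠ T in atTop, restrict T y = y := by
    obtain ⟨k, rfl⟩ := hy
    filter_upwards [eventually_ge_atTop k.support] with T hT
    ext η
    by_cases hη : η ∈ T
    · simp [restrict, hη]
    · simp [restrict, hη, DFinsupp.notMem_support_iff.1 fun h => hη (hT h)]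
  let φ (a : Finset B × ℕ × Finset (ℕ × X)) :=
    branchPart F s a.1 a.2.1 + restrict a.2.2 ∘ₗ (LinearMap.id - branchPart F s a.1 a.2.1)
  refine isPure_of_eventually_eq (l := atTop.curry (atTop.curry atTop))
    (fun a => (φ a).codRestrict (treeModule F s) fun y => add_mem
      (branchPart_mem_treeModule _ _ y) (finitelySupported_le_treeModule (restrict_mem _ _)))
    fun y => ?_
  refine eventually_curry_iff.2 ?_
  filter_upwards [eventually_sub_branchPart_mem_finitelySupported hs y.2] with W hW
  refine eventually_curry_iff.2 (hW.mono fun N hN => (eventually_restrict hN).mono fun T hT => ?_)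
  exact Subtype.ext ((congrArg (_ + ·) hT).trans (add_sub_cancel _ _))

end TreeModulePurity

section FilteredColimit

open Limits

variable {S : Type u} [Ring S] {J : Type} [SmallCategory J] {F : J ⥤ ModuleCat.{u} S}
  {c : Cocone F}

theorem cocone_app_map_apply {n k : J} (h : n ⟶ k) (x : F.obj n) :
    c.ι.app k (F.map h x) = c.ι.app n x := by
  rw [← ConcreteCategory.comp_apply, c.w]

variable [IsFiltered J]

theorem exists_map_eq_zero_of_isColimit (hc : IsColimit c) {n : J} {x : F.obj n}
    (hx : c.ι.app n x = 0) : ∃ (k : J) (h : n ⟶ k), F.map h x = 0 := by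
  have := preservesFilteredColimitsOfSize_shrink.{0, u, 0, u} (forget (ModuleCat.{u} S))
  obtain ⟨k, h, h', hk⟩ := (Concrete.isColimit_rep_eq_iff_exists F hc x (0 : F.obj n)).1
    (hx.trans (map_zero _).symm)
  exact ⟨k, h, hk.trans (map_zero (F.map h').hom)⟩

theorem exists_rep_of_isColimit (hc : IsColimit c) (m : c.pt) :
    ∃ (n : J) (x : F.obj n), c.ι.app n x = m := by
  have := preservesFilteredColimitsOfSize_shrink.{0, u, 0, u} (forget (ModuleCat.{u} S))
  exact Concrete.isColimit_exists_rep F hc m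

theorem nonempty_isColimit_of_exists_rep_of_exists_map_eq_zero
    (hrep : ∀ m : c.pt, ∃ (n : J) (x : F.obj n), c.ι.app n x = m)
    (hker : ∀ (n : J) (x : F.obj n), c.ι.app n x = 0 → ∃ (k : J) (h : n ⟶ k), F.map h x = 0) :
    Nonempty (IsColimit c) := by
  let d := (colimit.isColimit F).desc c
  have hd (n : J) (x : F.obj n) : d (colimit.ι F n x) = c.ι.app n x := by
    rw [← ConcreteCategory.comp_apply]
    exact congrArg (fun f => f.hom x) ((colimit.isColimit F).fac c n)
  have bijective : Function.Bijective d := by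
    refine ⟨(injective_iff_map_eq_zero d.hom).2 fun y hy => ?_, fun m => ?_⟩
    · obtain ⟨n, x, rfl⟩ := exists_rep_of_isColimit (colimit.isColimit F) y
      obtain ⟨k, h, hk⟩ := hker n x ((hd n x).symm.trans hy)
      exact (cocone_app_map_apply (c := colimit.cocone F) h x).symm.trans (by rw [hk, map_zero])
    · obtain ⟨n, x, rfl⟩ := hrep m
      exact ⟨_, hd n x⟩
  have : IsIso d := (ConcreteCategory.isIso_iff_bijective d).2 bijective
  exact ⟨IsColimit.ofPointIso (colimit.isColimit F)⟩

end FilteredColimit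

section BranchLimit

variable {S : Type u} [Ring S] {F : ℕ ⥤ ModuleCat.{u} S} {B X : Type u} {s : B → ℕ → X}
  {c : Limits.Cocone F}

variable (c) in
/-- `m` is the limit of the family `y` along the branches `s b`: the entry of `y` at the node
`(n, s b n)` represents `m b` in the direct limit for all large `n`. -/
def IsBranchLimit (s : B → ℕ → X) (y : ∀ η : ℕ × X, F.obj η.1) (m : B →₀ c.pt) : Prop :=
  ∀ b, ∀ᶠ n in atTop, c.ι.app n (y (n, s b n)) = m b

namespace IsBranchLimit

theorem add {y z : ∀ η : ℕ × X, F.obj η.1} {m m' : B →₀ c.pt} (hy : IsBranchLimit c s y m)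
    (hz : IsBranchLimit c s z m') : IsBranchLimit c s (y + z) (m + m') := fun b => by
  filter_upwards [hy b, hz b] with n hyn hzn
  rw [Pi.add_apply, map_add, hyn, hzn, Finsupp.add_apply]

theorem smul {y : ∀ η : ℕ × X, F.obj η.1} {m : B →₀ c.pt} (r : S) (hy : IsBranchLimit c s y m) :
    IsBranchLimit c s (r • y) (r • m) := fun b => by
  filter_upwards [hy b] with n hn
  rw [Pi.smul_apply, map_smul, hn, Finsupp.smul_apply]

theorem unique {y : ∀ η : ℕ × X, F.obj η.1} {m m' : B →₀ c.pt} (h : IsBranchLimit c s y m)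
    (h' : IsBranchLimit c s y m') : m = m' := Finsupp.ext fun b => by
  obtain ⟨n, hn, hn'⟩ := ((h b).and (h' b)).exists
  rw [← hn, hn']

theorem of_mem_finitelySupported {y : ∀ η : ℕ × X, F.obj η.1} (hy : y ∈ finitelySupported F X) :
    IsBranchLimit c s y 0 := fun b => by
  filter_upwards [eventually_apply_eq_zero hy] with n hn
  rw [hn, map_zero, Finsupp.zero_apply]

theorem thread (hs : IsAlmostDisjoint s) (b : B) (N : ℕ)
    (x : F.obj N) :
    IsBranchLimit c s (thread F (s b) N x) (Finsupp.single b (c.ι.app N x)) := fun b' => by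
  obtain rfl | hne := eq_or_ne b b'
  · filter_upwards [eventually_ge_atTop N] with n hn
    rw [thread_apply_self hn, cocone_app_map_apply, Finsupp.single_eq_same]
  · filter_upwards [hs hne.symm] with n hn
    rw [thread_apply_of_ne (η := (n, s b' n)) hn, map_zero, Finsupp.single_eq_of_ne hne.symm]

theorem exists_of_mem_treeModule (hs : IsAlmostDisjoint s)
    {y : ∀ η : ℕ × X, F.obj η.1} (hy : y ∈ treeModule F s) : ∃ m, IsBranchLimit c s y m :=
  treeModule_induction (fun _ hy => ⟨0, of_mem_finitelySupported hy⟩)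
    (fun b N x => ⟨_, thread hs b N x⟩)
    (fun _ _ ⟨m, hm⟩ ⟨m', hm'⟩ => ⟨m + m', hm.add hm'⟩) hy

end IsBranchLimit

theorem exists_branchLimit_linearMap (hs : IsAlmostDisjoint s) :
    ∃ p : treeModule F s →ₗ[S] B →₀ c.pt, ∀ y : treeModule F s, IsBranchLimit c s y (p y) := by
  choose p hp using fun y : treeModule F s =>
    IsBranchLimit.exists_of_mem_treeModule (c := c) hs y.2
  exact ⟨{ toFun := p
           map_add' := fun y z => (hp (y + z)).unique ((hp y).add (hp z))
           map_smul' := fun r y => (hp (r • y)).unique ((hp y).smul r) }, hp⟩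

theorem mem_finitelySupported_of_isBranchLimit_zero (hc : Limits.IsColimit c)
    (hs : IsAlmostDisjoint s) {y : ∀ η : ℕ × X, F.obj η.1}
    (hy : y ∈ treeModule F s) (h : IsBranchLimit c s y 0) : y ∈ finitelySupported F X := by
  obtain ⟨W, hW⟩ := (eventually_sub_branchPart_mem_finitelySupported hs hy).exists
  have hzero : ∀ᶠ N in atTop, ∀ b ∈ W, c.ι.app N (y (N, s b N)) = 0 :=
    W.eventually_all.2 fun b _ => h b
  obtain ⟨N, hN, hN₀⟩ := (hW.and hzero).exists
  refine (Submodule.sub_mem_iff_left _ ?_).1 hN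
  rw [branchPart_apply]
  refine sum_mem fun b hb => ?_
  obtain ⟨k, h, hk⟩ := exists_map_eq_zero_of_isColimit hc (hN₀ b hb)
  exact thread_mem_finitelySupported (s b) hk

theorem branchLimit_surjective (hc : Limits.IsColimit c)
    (hs : IsAlmostDisjoint s) {p : treeModule F s →ₗ[S] B →₀ c.pt}
    (hp : ∀ y : treeModule F s, IsBranchLimit c s y (p y)) : Function.Surjective p := by
  intro m
  induction m using Finsupp.induction_linear with
  | zero => exact ⟨0, map_zero p⟩
  | add m m' hm hm' =>
    obtain ⟨y, rfl⟩ := hm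
    obtain ⟨z, rfl⟩ := hm'
    exact ⟨y + z, map_add p y z⟩
  | single b m =>
    obtain ⟨N, x, rfl⟩ := exists_rep_of_isColimit hc m
    exact ⟨⟨_, thread_mem_treeModule b N x⟩, (hp _).unique (IsBranchLimit.thread hs b N x)⟩

end BranchLimit

section TreeModuleExt

open Abelian Cardinal

variable {S : Type u} [Ring S] {F : ℕ ⥤ ModuleCat.{u} S} {c : Limits.Cocone F}

theorem subsingleton_ext_of_treeModule {B X : Type u} {s : B → ℕ → X} (hc : Limits.IsColimit c)
    (hs : IsAlmostDisjoint s) {C : ModuleCat.{u} S}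
    (hL : Subsingleton (Ext.{u} (ModuleCat.of S (treeModule F s)) C 1))
    (hcard : #((Π₀ η : ℕ × X, F.obj η.1) →ₗ[S] C) < 2 ^ #B) :
    Subsingleton (Ext.{u} c.pt C 1) := by
  obtain ⟨p, hp⟩ := exists_branchLimit_linearMap (c := c) hs
  let i : (Π₀ η : ℕ × X, F.obj η.1) →ₗ[S] treeModule F s :=
    (DFinsupp.coeFnLinearMap S).codRestrict _ fun k => finitelySupported_le_treeModule ⟨k, rfl⟩
  have hi : Function.Injective i := fun k k' h => DFunLike.coe_injective (congrArg Subtype.val h)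
  refine subsingleton_ext_of_mk_hom_lt C hi (branchLimit_surjective hc hs hp) ?_ hL hcard
  refine fun y => ⟨fun hy => ?_, ?_⟩
  · obtain ⟨k, hk⟩ := mem_finitelySupported_of_isBranchLimit_zero hc hs y.2 (hy ▸ hp y)
    exact ⟨k, Subtype.ext hk⟩
  · rintro ⟨k, rfl⟩
    exact (hp _).unique (.of_mem_finitelySupported ⟨k, rfl⟩)

theorem subsingleton_ext_of_isColimit_of_forall_treeModule (hc : Limits.IsColimit c)
    {C : ModuleCat.{u} S}
    (hL : ∀ (B X : Type u) (s : B → ℕ → X), IsAlmostDisjoint s →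
      Subsingleton (Ext.{u} (ModuleCat.of S (treeModule F s)) C 1)) :
    Subsingleton (Ext.{u} c.pt C 1) := by
  obtain ⟨X, hX, hpow⟩ := exists_two_power_le_mk_sequences ((Σ n, F.obj n) ⊕ C ⊕ ULift.{u} ℕ)
  have hinf : ℵ₀ ≤ #X := (aleph0_le_mk _).trans hX
  have hC : #C ≤ #X := (mk_le_of_injective (Sum.inr_injective.comp Sum.inl_injective)).trans hX
  have hF : #(Σ n, F.obj n) ≤ #X := (mk_le_of_injective Sum.inl_injective).trans hX
  have hnodes : #(Σ η : ℕ × X, F.obj η.1) ≤ #X := by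
    let node_entry (a : Σ η : ℕ × X, F.obj η.1) : X × Σ n, F.obj n := ⟨a.1.2, a.1.1, a.2⟩
    calc #(Σ η : ℕ × X, F.obj η.1) ≤ #(X × Σ n, F.obj n) :=
          mk_le_of_injective (f := node_entry) <| by
            rintro ⟨⟨n, x⟩, a⟩ ⟨⟨n', x'⟩, a'⟩ h; cases h; rfl
      _ = #X * #(Σ n, F.obj n) := mul_def _ _
      _ ≤ #X * #X := by gcongr
      _ = #X := mul_eq_self hinf
  have := infinite_iff.2 hinf
  obtain ⟨s, hs⟩ := exists_isAlmostDisjoint X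
  refine subsingleton_ext_of_treeModule hc hs (hL _ X s hs) ?_
  calc _ ≤ 2 ^ #X := mk_dfinsupp_hom_le hinf hnodes hC
    _ ≤ #(ℕ → X) := hpow
    _ < 2 ^ #(ℕ → X) := cantor _

end TreeModuleExt

section CountableDirectLimits

variable {R : Type u} [Ring R]

theorem leftPerp_of_isColimit_sequence {𝒜 𝒞 : ObjectProperty (ModuleCat.{u} Rᵐᵒᵖ)}
    (hprod : ClosedUnderProducts 𝒜)
    (hpure : ∀ P, 𝒜.isoClosure P → ∀ N : Submodule Rᵐᵒᵖ P, IsPure N →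
      leftPerp 𝒞 (ModuleCat.of Rᵐᵒᵖ N))
    {F : ℕ ⥤ ModuleCat.{u} Rᵐᵒᵖ} (hF : ∀ n, 𝒜 (F.obj n)) {c : Limits.Cocone F}
    (hc : Limits.IsColimit c) : leftPerp 𝒞 c.pt := by
  refine fun C hC => subsingleton_ext_of_isColimit_of_forall_treeModule hc fun B X s hs => ?_
  exact hpure _ (hprod (fun η : ℕ × X => F.obj η.1) fun η => hF η.1) _ (isPure_treeModule hs) C hC

theorem containsCountableDirectLimits_leftPerp {𝒜 𝒞 : ObjectProperty (ModuleCat.{u} Rᵐᵒᵖ)}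
    (hprod : ClosedUnderProducts 𝒜)
    (hpure : ∀ P, 𝒜.isoClosure P → ∀ N : Submodule Rᵐᵒᵖ P, IsPure N →
      leftPerp 𝒞 (ModuleCat.of Rᵐᵒᵖ N)) :
    ContainsCountableDirectLimits (leftPerp 𝒞) 𝒜 := by
  intro J _ _ _ _ F hF c hc
  let G := Limits.IsFiltered.sequentialFunctor J
  exact leftPerp_of_isColimit_sequence hprod hpure (fun n => hF (G.obj n))
    ((Functor.Final.isColimitWhiskerEquiv G c).symm hc)

end CountableDirectLimits

section CountablyPresented

open Limits

-- `C n` collects the finitely many products `θ (n - 1) * ⋯ * θ j`, so that `θ n` can be chosen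
-- with all of them in view.
theorem exists_sequence_of_forall_finset {V : Type*} [MulOneClass V]
    {P : Finset V → ℕ → V → Prop} (h : ∀ C n, ∃ θ, P C n θ) :
    ∃ (θ : ℕ → V) (C : ℕ → Finset V), (∀ n, P (C n) n (θ n)) ∧ (∀ n, 1 ∈ C n) ∧
      ∀ n, ∀ c ∈ C n, θ n * c ∈ C (n + 1) := by
  classical
  choose θ hθ using h
  let C : ℕ → Finset V := Nat.rec {1} fun n D => insert 1 (D.image (θ D n * ·))
  refine ⟨fun n => θ (C n) n, C, fun n => hθ _ _, fun n => ?_, fun n c hc => ?_⟩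
  · cases n <;> simp [C]
  · exact Finset.mem_insert_of_mem (Finset.mem_image_of_mem _ hc)

/-- The endomorphisms `θ` of `E` over `M`, that is, those with `p ∘ θ = p`. -/
def endomorphismsOver {S E M : Type*} [Ring S] [AddCommGroup E] [Module S E] [AddCommGroup M]
    [Module S M] (p : E →ₗ[S] M) : Submonoid (Module.End S E) where
  carrier := {θ | p ∘ₗ θ = p}
  one_mem' := p.comp_id
  mul_mem' {θ η} hθ hη := by
    change (p ∘ₗ θ) ∘ₗ η = p
    rw [hθ, hη]

section Flat

variable {R : Type u} [Ring R] {ι : Type} {E M : Type u} [AddCommGroup E] [Module Rᵐᵒᵖ E]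
  [AddCommGroup M] [Module Rᵐᵒᵖ M] {p : E →ₗ[Rᵐᵒᵖ] M}

theorem IsFlat.exists_endomorphismsOver_apply_eq_zero (hM : IsFlat R M)
    (b : Module.Basis ι Rᵐᵒᵖ E) (hp : Function.Surjective p) {x : E} (hx : p x = 0) :
    ∃ θ ∈ endomorphismsOver p, θ x = 0 := by
  classical
  let T := (b.repr x).support
  have hsum : x = ∑ i : T, b.repr x i • b i := by
    conv_lhs => rw [← b.linearCombination_repr x, Finsupp.linearCombination_apply, Finsupp.sum,
      ← Finset.sum_coe_sort]
  obtain ⟨l, κ, y, hκ, hy⟩ := hM.equational_criterion (m := fun i : T => p (b i))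
    (r := fun i => (b.repr x i).unop) (by
      have hx' := congrArg p hsum
      simp only [hx, map_sum, map_smul] at hx'
      simpa only [MulOpposite.op_unop] using hx'.symm)
  choose z hz using fun s => hp (y s)
  let θ : E →ₗ[Rᵐᵒᵖ] E := b.constr ℕ fun i =>
    if h : i ∈ T then ∑ s, MulOpposite.op (κ s ⟨i, h⟩) • z s else b i
  have hθ (i : T) : θ (b i) = ∑ s, MulOpposite.op (κ s i) • z s := by
    simp [θ]
  refine ⟨θ, b.ext fun i => ?_, ?_⟩
  · by_cases hi : i ∈ T
    · simpa [hz, ← hy ⟨i, hi⟩] using congrArg p (hθ ⟨i, hi⟩)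
    · simp [θ, hi]
  · calc θ x = ∑ i : T, b.repr x i • ∑ s, MulOpposite.op (κ s i) • z s := by
          conv_lhs => rw [hsum]
          simp only [map_sum, map_smul, hθ]
      _ = ∑ s, MulOpposite.op (∑ i, κ s i * (b.repr x i).unop) • z s := by
          simp only [Finset.smul_sum, smul_smul, Finset.op_sum, MulOpposite.op_mul,
            MulOpposite.op_unop, Finset.sum_smul]
          exact Finset.sum_comm
      _ = 0 := by simp only [hκ, MulOpposite.op_zero, zero_smul, Finset.sum_const_zero]

theorem IsFlat.exists_endomorphismsOver_forall_apply_eq_zero (hM : IsFlat R M)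
    (b : Module.Basis ι Rᵐᵒᵖ E) (hp : Function.Surjective p) {T : Set E} (hfin : T.Finite)
    (hT : ∀ x ∈ T, p x = 0) : ∃ θ ∈ endomorphismsOver p, ∀ x ∈ T, θ x = 0 := by
  induction T, hfin using Set.Finite.induction_on with
  | empty => exact ⟨1, one_mem _, by simp⟩
  | @insert x T _ _ ih =>
    obtain ⟨θ, hθ, hθT⟩ := ih fun y hy => hT y (Set.mem_insert_of_mem x hy)
    have hθx : p (θ x) = 0 := (LinearMap.congr_fun hθ x).trans (hT x (Set.mem_insert x T))
    obtain ⟨η, hη, hηx⟩ := hM.exists_endomorphismsOver_apply_eq_zero b hp hθx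
    refine ⟨η * θ, mul_mem hη hθ, Set.forall_mem_insert.2 ⟨hηx, fun y hy => ?_⟩⟩
    rw [Module.End.mul_apply, hθT y hy, map_zero]

end Flat

section Sequence

variable {S : Type u} [Ring S] {E M : Type u} [AddCommGroup E] [Module S E] [AddCommGroup M]
  [Module S M]

/-- The direct system `E → E → E → ⋯` with transition maps `θ 0, θ 1, …`. -/
def endomorphismSystem (θ : ℕ → Module.End S E) : ℕ ⥤ ModuleCat.{u} S :=
  Functor.ofSequence (X := fun _ => ModuleCat.of S E) fun n => ModuleCat.ofHom (θ n)

theorem endomorphismSystem_map_refl (θ : ℕ → Module.End S E) (n : ℕ) (y : E) :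
    (endomorphismSystem θ).map (homOfLE (le_refl n)) y = y :=
  ConcreteCategory.congr_hom (CategoryTheory.Functor.map_id (endomorphismSystem θ) n) y

theorem endomorphismSystem_map_succ (θ : ℕ → Module.End S E) {j n : ℕ} (h : j ≤ n) (y : E) :
    (endomorphismSystem θ).map (homOfLE (h.trans n.le_succ)) y =
      θ n ((endomorphismSystem θ).map (homOfLE h) y) := by
  rw [← homOfLE_comp h n.le_succ, Functor.map_comp]
  unfold endomorphismSystem
  rw [Functor.ofSequence_map_homOfLE_succ]
  rfl

theorem exists_endomorphismSystem_map_eq {θ : ℕ → Module.End S E}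
    {C : ℕ → Set (Module.End S E)} (hone : ∀ n, 1 ∈ C n)
    (hmul : ∀ n, ∀ c ∈ C n, θ n * c ∈ C (n + 1)) {j n : ℕ} (h : j ≤ n) :
    ∃ c ∈ C n, ∀ y : E, (endomorphismSystem θ).map (homOfLE h) y = c y := by
  induction n, h using Nat.le_induction with
  | base => exact ⟨1, hone j, endomorphismSystem_map_refl θ j⟩
  | succ n h ih =>
    obtain ⟨c, hc, hcF⟩ := ih
    exact ⟨θ n * c, hmul n c hc,
      fun y => (endomorphismSystem_map_succ θ h y).trans (congrArg (θ n) (hcF y))⟩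

variable {p : E →ₗ[S] M} {x : ℕ → E}

theorem exists_endomorphismSystem_map_eq_zero (hx : ∀ i, p (x i) = 0)
    (hkill : ∀ T : Set E, T.Finite → (∀ y ∈ T, p y = 0) →
      ∃ θ ∈ endomorphismsOver p, ∀ y ∈ T, θ y = 0) :
    ∃ θ : ℕ → endomorphismsOver p, ∀ (j i k : ℕ) (h : j ≤ k), i ≤ k →
      (endomorphismSystem fun n => (θ n).1).map (homOfLE (h.trans k.le_succ)) (x i) = 0 := by
  have exists_killing (C : Finset (endomorphismsOver p)) (n : ℕ) :
      ∃ θ : endomorphismsOver p, ∀ c ∈ C, ∀ i ≤ n, θ.1 (c.1 (x i)) = 0 := by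
    obtain ⟨θ, hθ, hθ0⟩ := hkill
      (Set.image2 (fun (c : endomorphismsOver p) i => c.1 (x i)) C (Set.Iic n))
      (C.finite_toSet.image2 _ (Set.finite_Iic n)) (by
        rintro _ ⟨c, -, i, -, rfl⟩
        exact (LinearMap.congr_fun c.2 (x i)).trans (hx i))
    exact ⟨⟨θ, hθ⟩, fun c hc i hi => hθ0 _ ⟨c, hc, i, hi, rfl⟩⟩
  obtain ⟨θ, C, hθ, hone, hmul⟩ := exists_sequence_of_forall_finset exists_killing
  refine ⟨θ, fun j i k h hik => ?_⟩
  obtain ⟨_, ⟨c, hc, rfl⟩, hcF⟩ := exists_endomorphismSystem_map_eq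
    (θ := fun n => (θ n).1) (C := fun n => Subtype.val '' (C n : Set (endomorphismsOver p)))
    (fun n => ⟨1, hone n, rfl⟩)
    (by rintro n _ ⟨c, hc, rfl⟩; exact ⟨θ n * c, hmul n c hc, rfl⟩) h
  rw [endomorphismSystem_map_succ _ h, hcF]
  exact hθ k c hc i hik

theorem exists_isColimit_endomorphismSystem (hp : Function.Surjective p)
    (hx : Submodule.span S (Set.range x) = LinearMap.ker p)
    (hkill : ∀ T : Set E, T.Finite → (∀ y ∈ T, p y = 0) →
      ∃ θ ∈ endomorphismsOver p, ∀ y ∈ T, θ y = 0) :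
    ∃ (θ : ℕ → Module.End S E)
      (α : endomorphismSystem θ ⟶ (Functor.const ℕ).obj (ModuleCat.of S M)),
      Nonempty (IsColimit ⟨ModuleCat.of S M, α⟩) := by
  obtain ⟨θ, hθ⟩ := exists_endomorphismSystem_map_eq_zero
    (fun i => LinearMap.mem_ker.1 (hx ▸ Submodule.subset_span (Set.mem_range_self i))) hkill
  let F := endomorphismSystem fun n => (θ n).1
  have eventually_zero (j : ℕ) {y : E} (hy : y ∈ Submodule.span S (Set.range x)) :
      ∀ᶠ n in atTop, ∀ h : j ≤ n, F.map (homOfLE h) y = 0 := by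
    induction hy using Submodule.span_induction with
    | mem y hy =>
      obtain ⟨i, rfl⟩ := hy
      filter_upwards [eventually_gt_atTop (max j i)] with n hn h
      obtain ⟨k, rfl⟩ := Nat.exists_eq_add_one_of_ne_zero (Nat.ne_zero_of_lt hn)
      have hk := max_le_iff.1 (Nat.lt_succ_iff.1 hn)
      exact hθ j i k hk.1 hk.2
    | zero => exact .of_forall fun _ _ => map_zero _
    | add y z _ _ hy hz =>
      filter_upwards [hy, hz] with n hy hz h
      exact (map_add _ _ _).trans (by rw [hy h, hz h, add_zero])
    | smul r y _ hy =>
      filter_upwards [hy] with n hy h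
      exact (map_smul _ _ _).trans (by rw [hy h, smul_zero])
  refine ⟨fun n => (θ n).1, NatTrans.ofSequence (fun _ => ModuleCat.ofHom p) fun n => ?_,
    nonempty_isColimit_of_exists_rep_of_exists_map_eq_zero (fun m => ?_) fun n y hy => ?_⟩
  · ext y
    refine Eq.trans (congrArg p ?_) (LinearMap.congr_fun (θ n).2 y)
    exact (endomorphismSystem_map_succ _ le_rfl y).trans
      (congrArg (θ n).1 (endomorphismSystem_map_refl _ n y))
  · obtain ⟨y, hy⟩ := hp m
    exact ⟨0, y, hy⟩
  · obtain ⟨k, hk, hnk⟩ := ((eventually_zero n (hx.ge hy)).and (eventually_ge_atTop n)).exists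
    exact ⟨k, homOfLE hnk, hk hnk⟩

end Sequence

theorem IsFlat.exists_isColimit_of_isCountablyPresented {R M : Type u} [Ring R] [AddCommGroup M]
    [Module Rᵐᵒᵖ M] (hM : IsFlat R M) (hpres : IsCountablyPresented R M) :
    ∃ (F : ℕ ⥤ ModuleCat.{u} Rᵐᵒᵖ) (α : F ⟶ (Functor.const ℕ).obj (ModuleCat.of Rᵐᵒᵖ M)),
      (∀ n, Module.Free Rᵐᵒᵖ (F.obj n)) ∧ Nonempty (IsColimit ⟨ModuleCat.of Rᵐᵒᵖ M, α⟩) := by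
  obtain ⟨ι, _, p, hp, S, hS, hspan⟩ := hpres
  obtain ⟨x, hx⟩ := (hS.insert 0).exists_eq_range (Set.insert_nonempty 0 S)
  obtain ⟨θ, α, hα⟩ := exists_isColimit_endomorphismSystem hp
    (by rw [← hx, Submodule.span_insert_zero, hspan])
    fun T => hM.exists_endomorphismsOver_forall_apply_eq_zero Finsupp.basisSingleOne hp
  exact ⟨endomorphismSystem θ, α, fun n => inferInstanceAs (Module.Free _ (ι →₀ Rᵐᵒᵖ)), hα⟩

end CountablyPresented

end RightMod

end

theorem mainTheorem10 {R : Type u} [Ring R] :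
    (∀ 𝒜' 𝒜 𝒞 : ObjectProperty (ModuleCat.{u} Rᵐᵒᵖ),
      RightMod.ClosedUnderProducts 𝒜' →
      𝒜' ≤ 𝒜 →
      𝒜 = RightMod.leftPerp 𝒞 →
      RightMod.ClosedUnderPureSubmodules 𝒜 →
      RightMod.ContainsCountableDirectLimits 𝒜 𝒜') ∧
    (∀ 𝒬 : ObjectProperty (ModuleCat.{u} R),
      RightMod.ClosedUnderProducts (RightMod.flatMittagLeffler 𝒬) →
      RightMod.ContainsCountableDirectLimits
        (RightMod.leftPerp (RightMod.rightPerp (RightMod.flatMittagLeffler 𝒬)))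
        (RightMod.flatMittagLeffler 𝒬) ∧
      ∀ M : ModuleCat.{u} Rᵐᵒᵖ,
        RightMod.IsCountablyPresented R M → RightMod.IsFlat R M →
          RightMod.leftPerp (RightMod.rightPerp (RightMod.flatMittagLeffler 𝒬)) M) ∧
    (IsNoetherianRing R → ∀ 𝒬 : ObjectProperty (ModuleCat.{u} R),
      RightMod.ClosedUnderProducts (RightMod.flatMittagLeffler 𝒬)) := by
  refine ⟨?_, fun 𝒬 hprod => ?_, fun _ => RightMod.closedUnderProducts_flatMittagLeffler⟩
  · rintro 𝒜' _ 𝒞 hprod hle rfl hpure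
    refine RightMod.containsCountableDirectLimits_leftPerp hprod fun P hP => hpure P ?_
    exact RightMod.isoClosure_leftPerp 𝒞 ▸ ObjectProperty.monotone_isoClosure hle P hP
  · have hlim := RightMod.containsCountableDirectLimits_leftPerp hprod fun P hP N hN =>
      RightMod.le_leftPerp_rightPerp _ _ <|
        RightMod.closedUnderPureSubmodules_flatMittagLeffler 𝒬 P
          (RightMod.flatMittagLeffler_isoClosure_le 𝒬 P hP) N hN
    refine ⟨hlim, fun M hM hflat => ?_⟩
    obtain ⟨F, α, hfree, ⟨hα⟩⟩ := hflat.exists_isColimit_of_isCountablyPresented hM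
    exact hlim ℕ F (fun n => RightMod.flatMittagLeffler_of_free 𝒬) _ hα
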